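/- \textbf{Setting.} For an integer $N\ge 1$ let $\Lambda_N=\{k\in\mathbb Z^3\setminus\{0\}:|k|_\infty\le N\}$, let $|k|^2=k_1^2+k_2^2+k_3^2$, let $P(k)=I-\frac{k\otimes k}{|k|^2}$, and let $\mathcal O_N$ be the set of orbits $\Omega_\alpha$ of the full octahedral group $O_h$ (signed coordinate permutations) on $\Lambda_N$. For $\hat u=(\hat u_k)_{k\in\Lambda_N}$, $\hat u_k\in\mathbb C^3$, put \[ S_{\alpha\beta}=\frac1{|\Omega_\alpha|}\sum_{k\in\Omega_\alpha}\ \sum_{\substack{p\in\Omega_\beta\\ q=k-p\in\Lambda_N}}|k|^2\,\mathrm{Re}\Bigl(\overline{\hat u_k}\cdot\bigl(-i\,P(k)[\,q\,(\hat u_p\cdot\hat u_q)]\bigr)\Bigr),\qquad V_{\alpha\beta}=\tfrac12(S_{\alpha\beta}+S_{\beta\alpha}), \] where $a\cdot b=\sum_i a_ib_i$. Let $V_N=(V_{\alpha\beta})$ be the stretching matrix, $\rho(V_N)$ its spectral radius and $\|V_N\|_\infty$ its $\ell^\infty$ operator norm (maximal absolute row sum). \textbf{Isotropic ensemble.} For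 each $N$, let $X_k\in\mathbb C^3$, with $k$ in a half of $\Lambda_N$ that contains exactly one of $k$ and $-k$, have independent standard complex Gaussian coordinates, and set $X_{-k}=\overline{X_k}$. Let $s\in\{0,1\}$ be fixed, put $v_k=|k|^{-s}P(k)X_k$, and normalize: \[ \hat u_k=\frac{v_k}{\sqrt W},\qquad W=\frac12\sum_{k\in\Lambda_N}|k|^2|v_k|^2, \qquad\text{so that}\qquad \frac12\sum_{k\in\Lambda_N}|k|^2|\hat u_k|^2=1\ \text{ almost surely.} \] \textbf{Proposition.} For $V_N$ evaluated at this random $\hat u$, $\|V_N\|_\infty$ is square integrable for every $N\ge 1$, and there is a constant $C>0$, independent of $N$, such that for all $N\ge1$ \[ \operatorname{Var}\bigl(\|V_N\|_\infty\bigr)\le C\,N^{-2}, \] and, with the same $C$, for all $N\ge 1$ and all $\delta>0$, \[ \mathbb P\bigl(\|V_N\|_\infty>\mathbb E\|V_N\|_\infty+\delta\bigr)\le\frac{C\,N^{-2}}{\delta^2}. \] Moreover, for every $\varepsilon>0$ and every fixed $\gamma>\tfrac12+\varepsilon$, \[ \mathbb P\bigl(\rho(V_N)>N^{\gamma}\bigr)\to0\qquad(N\to\infty).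 \] -/

import Mathlib

open MeasureTheory ProbabilityTheory Filter Topology
open scoped Matrix ENNReal NNReal ComplexConjugate

namespace OctahedralGalerkin

noncomputable section

/-- The truncated nonzero lattice `Λ_N = {k ∈ ℤ³ ∖ {0} : |k|_∞ ≤ N}`. -/
def lattice (N : ℕ) : Finset (Fin 3 → ℤ) :=
  (Fintype.piFinset fun _ : Fin 3 => Finset.Icc (-(N : ℤ)) (N : ℤ)).erase 0

/-- `|k|² = k₁² + k₂² + k₃²`. -/
def normSq (k : Fin 3 → ℤ) : ℝ := ∑ i, (k i : ℝ) ^ 2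

/-- An integer vector viewed in `ℂ³`. -/
def toC (k : Fin 3 → ℤ) : Fin 3 → ℂ := fun i => (k i : ℂ)

/-- The Leray projector `P(k) = I - k ⊗ k / |k|²`. -/
def leray (k : Fin 3 → ℤ) : Matrix (Fin 3) (Fin 3) ℂ :=
  1 - ((normSq k : ℂ))⁻¹ • Matrix.vecMulVec (toC k) (toC k)

/-- Two modes of `Λ_N` are related if a signed coordinate permutation (an element of the full
octahedral group `O_h`) maps one to the other. -/
def octahedralSetoid (N : ℕ) : Setoid (lattice N) where
  r k l := ∃ (σ : Equiv.Perm (Fin 3)) (e : Fin 3 → ℤˣ), ∀ i, l.1 i = (e i : ℤ) * k.1 (σ i)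
  iseqv :=
    { refl := fun k => ⟨1, 1, fun i => by simp⟩
      symm := by
        rintro k l ⟨σ, e, h⟩
        refine ⟨σ.symm, fun i => e (σ.symm i), fun i => ?_⟩
        have h1 := h (σ.symm i)
        rw [Equiv.apply_symm_apply] at h1
        rw [h1, ← mul_assoc, ← Units.val_mul, Int.units_mul_self]
        simp
      trans := by
        rintro k l m ⟨σ, e, h⟩ ⟨τ, d, h'⟩
        refine ⟨σ * τ, fun i => d i * e (τ i), fun i => ?_⟩
        rw [h' i, h (τ i)]
        simp [mul_assoc] }

/-- The orbit set `𝒪_N = Λ_N / O_h`. -/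
abbrev Orbits (N : ℕ) : Type := Quotient (octahedralSetoid N)

instance (N : ℕ) : Fintype (Orbits N) := Fintype.ofFinite _

instance (N : ℕ) : DecidableEq (Orbits N) := Classical.decEq _

/-- The modes `Ω_α` in the orbit `α`. -/
def orbitModes {N : ℕ} (α : Orbits N) : Finset (lattice N) :=
  Finset.univ.filter fun k => (Quotient.mk _ k : Orbits N) = α

/-- The interaction `N_{k,p} = -i P(k)[q (û_p · û_q)]` with `q = k - p`; the dot product is
bilinear. -/
def interaction (u : (Fin 3 → ℤ) → Fin 3 → ℂ) (k p : Fin 3 → ℤ) : Fin 3 → ℂ :=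
  (-Complex.I) • (leray k *ᵥ ((u p ⬝ᵥ u (k - p)) • toC (k - p)))

/-- The raw orbit-pair transfer
`S_{αβ} = |Ω_α|⁻¹ ∑_{k ∈ Ω_α} ∑_{p ∈ Ω_β, k - p ∈ Λ_N} |k|² Re (conj û_k · N_{k,p})`. -/
def transfer (N : ℕ) (u : (Fin 3 → ℤ) → Fin 3 → ℂ) : Matrix (Orbits N) (Orbits N) ℝ :=
  Matrix.of fun α β =>
    ((orbitModes α).card : ℝ)⁻¹ *
      ∑ k ∈ orbitModes α, ∑ p ∈ (orbitModes β).filter (fun p => k.1 - p.1 ∈ lattice N),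
        normSq k.1 * (star (u k.1) ⬝ᵥ interaction u k.1 p.1).re

/-- The stretching matrix `V_N`, the symmetric part of the transfer matrix. -/
def stretching (N : ℕ) (u : (Fin 3 → ℤ) → Fin 3 → ℂ) : Matrix (Orbits N) (Orbits N) ℝ :=
  Matrix.of fun α β => (transfer N u α β + transfer N u β α) / 2

section Norm

attribute [local instance] Matrix.linftyOpNormedAddCommGroup

/-- The matrix `ℓ^∞` norm (maximal absolute row sum). -/
def linftyNorm {ι : Type*} [Fintype ι] (A : Matrix ι ι ℝ) : ℝ := ‖A‖

end Norm

/-- The spectral radius of a real matrix: the largest modulus of a complex eigenvalue. -/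
def rho {ι : Type*} [Fintype ι] [DecidableEq ι] (A : Matrix ι ι ℝ) : ℝ :=
  (spectralRadius ℂ (A.map (fun x : ℝ => (x : ℂ)))).toReal

/-- The standard complex Gaussian law: independent real and imaginary parts of law `𝓝(0, 1/2)`. -/
def stdComplexGaussian : Measure ℂ :=
  ((gaussianReal 0 (1 / 2)).prod (gaussianReal 0 (1 / 2))).map
    (fun z : ℝ × ℝ => (⟨z.1, z.2⟩ : ℂ))

instance : IsProbabilityMeasure stdComplexGaussian :=
  Measure.isProbabilityMeasure_map Complex.measurableEquivRealProd.symm.measurable.aemeasurable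

/-- A half-lattice: the lexicographically positive modes of `Λ_N`, one out of each pair `±k`. -/
def halfLattice (N : ℕ) : Finset (Fin 3 → ℤ) :=
  (lattice N).filter fun k =>
    0 < k 0 ∨ (k 0 = 0 ∧ 0 < k 1) ∨ (k 0 = 0 ∧ k 1 = 0 ∧ 0 < k 2)

/-- The basic coordinates: one vector of `ℂ³` for each mode of the half-lattice. -/
abbrev Coords (N : ℕ) : Type := halfLattice N → Fin 3 → ℂ

/-- The law of the basic coordinates: all of them independent standard complex Gaussians. -/
def ensemble (N : ℕ) : Measure (Coords N) :=
  Measure.pi fun _ => Measure.pi fun _ => stdComplexGaussian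

instance (N : ℕ) : IsProbabilityMeasure (ensemble N) := by
  unfold ensemble
  infer_instance

/-- Extension of the coordinates to all modes by the reality constraint. -/
def extend {N : ℕ} (X : Coords N) (k : Fin 3 → ℤ) : Fin 3 → ℂ :=
  if h : k ∈ halfLattice N then X ⟨k, h⟩
  else if h : -k ∈ halfLattice N then star (X ⟨-k, h⟩)
  else 0

/-- The field before normalization, `v_k = |k|^{-s} P(k) X_k`. For `s = 0` it is the projection of
plain standard Gaussians; for `s = 1` it has `E |v_k|² = 2 / |k|²`. -/
def rawField (s : ℕ) {N : ℕ} (X : Coords N) (k : Fin 3 → ℤ) : Fin 3 → ℂ :=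
  (((Real.sqrt (normSq k) ^ s)⁻¹ : ℝ) : ℂ) • (leray k *ᵥ extend X k)

/-- The energy `W = ½ ∑_{k ∈ Λ_N} |k|² |v_k|²`. -/
def energy (N : ℕ) (v : (Fin 3 → ℤ) → Fin 3 → ℂ) : ℝ :=
  (1 / 2) * ∑ k ∈ lattice N, normSq k * ∑ i, ‖v k i‖ ^ 2

/-- The normalized random field `û_k = v_k / √W`. -/
def field (s : ℕ) {N : ℕ} (X : Coords N) (k : Fin 3 → ℤ) : Fin 3 → ℂ :=
  (((Real.sqrt (energy N (rawField s X)))⁻¹ : ℝ) : ℂ) • rawField s X k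

/-- The random stretching matrix `V_N`. -/
def V (s N : ℕ) (X : Coords N) : Matrix (Orbits N) (Orbits N) ℝ :=
  stretching N (field s X)

end

end OctahedralGalerkin

namespace OctahedralGalerkin

/-! Write `a_k = |k| |û_k|`, so that `∑ a_k² ≤ 2`. Incompressibility removes the projector and gives
`conj û_k · q = -conj û_k · p`, hence a derivative may be put on the smaller of `|p|`, `|q|`. Since
`|k| ≤ 2 max(|p|, |q|)`, each triad contributes at most `2 a_k a_p a_q` (`abs_transfer_term_le`).
Summing over one index, with `a_p a_q` controlled by the total enstrophy and orbits of size at most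
48, yields `‖V_N‖_∞ ≤ 98 max a_k` (`linftyNorm_stretching_le`).

It remains to see that the normalized field has no large mode: `E max a_k² = O(N⁻²)`. The numerator
of `a_k²` involves a single Gaussian mode, whereas the normalization is comparable to at least a sum
(`bulk`) over `n ≥ N³` independent modes, with mean `2n` and variance `O(n)`. When `bulk < n`, the
trivial bound `a_k² ≤ 2` is paid for by Chebyshev. Otherwise `a_k² ≤ 24 y / n`, where the largest
`y` is at most `N + N⁻² ∑ |X_j|⁶`, of mean `O(N)`. Both cases are merged in the integrable
`majorant`.

The second moment of `‖V_N‖_∞` is thus `O(N⁻²)` and dominates the variance; Chebyshev gives the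
deviation bound. Since `ρ ≤ ‖·‖_∞` and `N^γ ≥ 1`, Markov's inequality gives the last claim. -/

/-! ### Euclidean estimates and the Leray projector -/

/-- The squared Euclidean norm of a vector of `ℂ³`. -/
noncomputable def sqNorm (z : Fin 3 → ℂ) : ℝ := ∑ i, ‖z i‖ ^ 2

lemma sqNorm_nonneg (z : Fin 3 → ℂ) : 0 ≤ sqNorm z :=
  Finset.sum_nonneg fun _ _ => sq_nonneg _

lemma normSq_nonneg (k : Fin 3 → ℤ) : 0 ≤ normSq k :=
  Finset.sum_nonneg fun _ _ => sq_nonneg _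

lemma one_le_normSq {k : Fin 3 → ℤ} (hk : k ≠ 0) : 1 ≤ normSq k := by
  have h : 0 < ∑ i, (k i) ^ 2 := by
    obtain ⟨i, hi⟩ := Function.ne_iff.1 hk
    exact Finset.sum_pos' (fun _ _ => sq_nonneg _) ⟨i, Finset.mem_univ _, sq_pos_of_ne_zero hi⟩
  have h1 : (1 : ℤ) ≤ ∑ i, (k i) ^ 2 := h
  unfold normSq
  exact_mod_cast h1

lemma sqNorm_toC (k : Fin 3 → ℤ) : sqNorm (toC k) = normSq k := by
  simp [sqNorm, normSq, toC]

lemma norm_dotProduct_le (a b : Fin 3 → ℂ) : ‖a ⬝ᵥ b‖ ≤ √(sqNorm a) * √(sqNorm b) := by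
  refine (norm_sum_le _ _).trans ?_
  simp only [norm_mul]
  exact Real.sum_mul_le_sqrt_mul_sqrt _ _ _

lemma sqNorm_star (a : Fin 3 → ℂ) : sqNorm (star a) = sqNorm a := by
  simp [sqNorm]

lemma sqNorm_real_smul (r : ℝ) (z : Fin 3 → ℂ) : sqNorm ((r : ℂ) • z) = r ^ 2 * sqNorm z := by
  simp [sqNorm, mul_pow, Finset.mul_sum]

lemma sqrt_normSq_add_le (p q : Fin 3 → ℤ) :
    √(normSq (p + q)) ≤ √(normSq p) + √(normSq q) := by
  have h := norm_add_le (WithLp.toLp 2 (fun i => (p i : ℝ)) : EuclideanSpace ℝ (Fin 3))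
    (WithLp.toLp 2 (fun i => (q i : ℝ)))
  simpa [EuclideanSpace.norm_eq, normSq] using h

lemma leray_mulVec (k : Fin 3 → ℤ) (z : Fin 3 → ℂ) :
    leray k *ᵥ z = z - (((normSq k : ℂ))⁻¹ * (toC k ⬝ᵥ z)) • toC k := by
  rw [leray, Matrix.sub_mulVec, Matrix.one_mulVec, Matrix.smul_mulVec, Matrix.vecMulVec_mulVec]
  ext i
  simp
  ring

lemma toC_dotProduct_toC (k : Fin 3 → ℤ) : toC k ⬝ᵥ toC k = (normSq k : ℂ) := by
  simp [dotProduct, toC, normSq, pow_two]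

lemma toC_dotProduct_leray_mulVec {k : Fin 3 → ℤ} (hk : k ≠ 0) (z : Fin 3 → ℂ) :
    toC k ⬝ᵥ (leray k *ᵥ z) = 0 := by
  have h0 : (normSq k : ℂ) ≠ 0 := by
    have := one_le_normSq hk
    exact_mod_cast (by linarith : (0 : ℝ) < normSq k).ne'
  rw [leray_mulVec, dotProduct_sub, dotProduct_smul, toC_dotProduct_toC, smul_eq_mul]
  field_simp
  ring

/-- Pythagoras for the component along the real vector `k`. The exact identity is needed, beyond
contraction, to compute the mean energy of a projected mode. -/
lemma sqNorm_leray_mulVec {k : Fin 3 → ℤ} (hk : k ≠ 0) (z : Fin 3 → ℂ) :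
    sqNorm (leray k *ᵥ z) = sqNorm z - (normSq k)⁻¹ * ‖toC k ⬝ᵥ z‖ ^ 2 := by
  have h0 : normSq k ≠ 0 := by
    have := one_le_normSq hk
    linarith
  rw [leray_mulVec]
  set d := toC k ⬝ᵥ z with hd
  have hdr : d.re = ∑ i, (k i : ℝ) * (z i).re := by
    simp [hd, dotProduct, toC]
  have hdi : d.im = ∑ i, (k i : ℝ) * (z i).im := by
    simp [hd, dotProduct, toC]
  have key : ∀ i, ‖(z - (((normSq k : ℂ))⁻¹ * d) • toC k) i‖ ^ 2
      = ‖z i‖ ^ 2 - 2 * (normSq k)⁻¹ * (d.re * ((k i : ℝ) * (z i).re)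
          + d.im * ((k i : ℝ) * (z i).im))
        + (normSq k)⁻¹ ^ 2 * (d.re ^ 2 + d.im ^ 2) * (k i : ℝ) ^ 2 := by
    intro i
    rw [← Complex.normSq_eq_norm_sq, ← Complex.normSq_eq_norm_sq, ← Complex.ofReal_inv,
      Complex.normSq_apply, Complex.normSq_apply]
    simp [toC]
    ring
  have hn : ∑ i, (k i : ℝ) ^ 2 = normSq k := rfl
  simp only [sqNorm, key]
  rw [Finset.sum_add_distrib, Finset.sum_sub_distrib, ← Finset.mul_sum, ← Finset.mul_sum,
    Finset.sum_add_distrib, ← Finset.mul_sum, ← Finset.mul_sum, ← hdr, ← hdi, hn,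
    ← Complex.normSq_eq_norm_sq d, Complex.normSq_apply]
  field_simp
  ring

lemma sqNorm_leray_mulVec_le {k : Fin 3 → ℤ} (hk : k ≠ 0) (z : Fin 3 → ℂ) :
    sqNorm (leray k *ᵥ z) ≤ sqNorm z := by
  rw [sqNorm_leray_mulVec hk]
  have := normSq_nonneg k
  have : 0 ≤ (normSq k)⁻¹ * ‖toC k ⬝ᵥ z‖ ^ 2 := by positivity
  linarith

/-! ### Enstrophy amplitudes and the bound for one triad -/

/-- The enstrophy amplitude `|k| |u_k|` of a mode. -/
noncomputable def amp (u : (Fin 3 → ℤ) → Fin 3 → ℂ) (k : Fin 3 → ℤ) : ℝ :=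
  √(normSq k) * √(sqNorm (u k))

lemma amp_nonneg (u : (Fin 3 → ℤ) → Fin 3 → ℂ) (k : Fin 3 → ℤ) : 0 ≤ amp u k := by
  unfold amp; positivity

lemma amp_sq (u : (Fin 3 → ℤ) → Fin 3 → ℂ) (k : Fin 3 → ℤ) :
    amp u k ^ 2 = normSq k * sqNorm (u k) := by
  rw [amp, mul_pow, Real.sq_sqrt (normSq_nonneg k), Real.sq_sqrt (sqNorm_nonneg _)]

/-- For a divergence-free mode the projector can be dropped, and the wave vector `k - p` replaced
by `-p`. -/
lemma star_dotProduct_interaction (u : (Fin 3 → ℤ) → Fin 3 → ℂ) (k p : Fin 3 → ℤ)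
    (hu : toC k ⬝ᵥ u k = 0) :
    star (u k) ⬝ᵥ interaction u k p
        = -Complex.I * (u p ⬝ᵥ u (k - p)) * (star (u k) ⬝ᵥ toC (k - p)) ∧
      star (u k) ⬝ᵥ toC (k - p) = -(star (u k) ⬝ᵥ toC p) := by
  have hs : star (u k) ⬝ᵥ toC k = 0 := by
    have h := congrArg star hu
    rw [dotProduct_comm, ← Matrix.star_dotProduct_star, dotProduct_comm] at h
    have ht : star (toC k) = toC k := by ext i; simp [toC]
    rw [ht, star_zero] at h
    exact h
  refine ⟨?_, ?_⟩
  · rw [interaction, leray_mulVec, dotProduct_smul, dotProduct_sub, dotProduct_smul,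
      dotProduct_smul, hs]
    simp
    ring
  · have : toC (k - p) = toC k - toC p := by ext i; simp [toC]
    rw [this, dotProduct_sub, hs, zero_sub]

/-- One factor `|k|` goes into the amplitude of `u k`. The other is traded, together with the
derivative in the pairing, for `|p| |k - p|`; this makes the bound symmetric in the three modes. -/
lemma abs_transfer_term_le (u : (Fin 3 → ℤ) → Fin 3 → ℂ) (k p : Fin 3 → ℤ)
    (hu : toC k ⬝ᵥ u k = 0) :
    |normSq k * (star (u k) ⬝ᵥ interaction u k p).re|
      ≤ 2 * (amp u k * amp u p * amp u (k - p)) := by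
  obtain ⟨h1, h2⟩ := star_dotProduct_interaction u k p hu
  have hq : ‖star (u k) ⬝ᵥ toC (k - p)‖ ≤ √(sqNorm (u k)) * √(normSq (k - p)) := by
    simpa [sqNorm_star, sqNorm_toC] using norm_dotProduct_le (star (u k)) (toC (k - p))
  have hp : ‖star (u k) ⬝ᵥ toC (k - p)‖ ≤ √(sqNorm (u k)) * √(normSq p) := by
    rw [h2, norm_neg]
    simpa [sqNorm_star, sqNorm_toC] using norm_dotProduct_le (star (u k)) (toC p)
  have hd := norm_dotProduct_le (u p) (u (k - p))
  have htri := sqrt_normSq_add_le p (k - p)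
  rw [add_sub_cancel] at htri
  rw [abs_mul, abs_of_nonneg (normSq_nonneg k)]
  have hre := Complex.abs_re_le_norm (star (u k) ⬝ᵥ interaction u k p)
  rw [h1, norm_mul, norm_mul, norm_neg, Complex.norm_I, one_mul] at hre
  -- The rewriting by `h1` also changed the real part on the left, which is restored here.
  rw [← h1] at hre
  have hk := Real.mul_self_sqrt (normSq_nonneg k)
  unfold amp
  set K := √(normSq k)
  set P := √(normSq p)
  set Q := √(normSq (k - p))
  set a := √(sqNorm (u k))
  set b := √(sqNorm (u p))
  set c := √(sqNorm (u (k - p)))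
  have hK : 0 ≤ K := Real.sqrt_nonneg _
  have hP : 0 ≤ P := Real.sqrt_nonneg _
  have hQ : 0 ≤ Q := Real.sqrt_nonneg _
  have ha : 0 ≤ a := Real.sqrt_nonneg _
  have hb : 0 ≤ b := Real.sqrt_nonneg _
  have hc : 0 ≤ c := Real.sqrt_nonneg _
  -- `K ≤ P + Q` is at most twice the larger of `P`, `Q`, while the pairing is bounded using the
  -- smaller.
  have hmin : K * ‖star (u k) ⬝ᵥ toC (k - p)‖ ≤ 2 * (a * (P * Q)) := by
    rcases le_total P Q with h | h
    · calc _ ≤ (2 * Q) * (a * P) := by gcongr; linarith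
        _ = _ := by ring
    · calc _ ≤ (2 * P) * (a * Q) := by gcongr; linarith
        _ = _ := by ring
  calc normSq k * |(star (u k) ⬝ᵥ interaction u k p).re|
      ≤ (K * K) * ((b * c) * ‖star (u k) ⬝ᵥ toC (k - p)‖) := by
        rw [hk]
        exact mul_le_mul_of_nonneg_left
          (hre.trans (mul_le_mul_of_nonneg_right hd (norm_nonneg _))) (normSq_nonneg k)
    _ = (K * b * c) * (K * ‖star (u k) ⬝ᵥ toC (k - p)‖) := by ring
    _ ≤ (K * b * c) * (2 * (a * (P * Q))) := by gcongr
    _ = _ := by ring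

/-! ### The `ℓ^∞` norm and the spectral radius -/

section

attribute [local instance] Matrix.linftyOpNormedAddCommGroup

lemma linftyNorm_eq {ι : Type*} [Fintype ι] (A : Matrix ι ι ℝ) :
    linftyNorm A = ((Finset.univ.sup fun i => ∑ j, ‖A i j‖₊ : ℝ≥0) : ℝ) :=
  Matrix.linfty_opNorm_def A

lemma linftyNorm_nonneg {ι : Type*} [Fintype ι] (A : Matrix ι ι ℝ) : 0 ≤ linftyNorm A := by
  rw [linftyNorm_eq]; positivity

end

lemma linftyNorm_le {ι : Type*} [Fintype ι] {A : Matrix ι ι ℝ} {r : ℝ} (hr : 0 ≤ r)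
    (h : ∀ i, ∑ j, |A i j| ≤ r) : linftyNorm A ≤ r := by
  lift r to ℝ≥0 using hr
  rw [linftyNorm_eq]
  norm_cast
  refine Finset.sup_le fun i _ => ?_
  rw [← NNReal.coe_le_coe]
  simpa using h i

section

attribute [local instance] Matrix.linftyOpNormedRing Matrix.linftyOpNormedAlgebra

/-- The spectral radius is at most the `ℓ^∞` norm. -/
lemma rho_le_linftyNorm {ι : Type*} [Fintype ι] [DecidableEq ι] (A : Matrix ι ι ℝ) :
    rho A ≤ linftyNorm A := by
  -- Without indices (as for `N = 0`) the matrix algebra is trivial and its unit has norm zero, so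
  -- the general bound on the spectral radius requires `ι` nonempty.
  rcases isEmpty_or_nonempty ι with hι | hι
  · have : rho A = 0 := by
      have : Subsingleton (Matrix ι ι ℂ) := inferInstance
      simp [rho, spectralRadius, spectrum.of_subsingleton]
    rw [this]
    exact linftyNorm_nonneg A
  · have : NormOneClass (Matrix ι ι ℂ) := inferInstance
    have h := spectrum.spectralRadius_le_nnnorm (𝕜 := ℂ) (A.map (fun x : ℝ => (x : ℂ)))
    have h2 := ENNReal.toReal_mono ENNReal.coe_ne_top h
    refine h2.trans ?_
    rw [linftyNorm_eq, ENNReal.coe_toReal, NNReal.coe_le_coe, Matrix.linfty_opNNNorm_def]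
    simp

end

/-! ### Orbit sums and the deterministic bound -/

variable {N : ℕ} {u : (Fin 3 → ℤ) → Fin 3 → ℂ}

lemma sum_sum_orbitModes (f : lattice N → ℝ) (Q : lattice N → Prop) [DecidablePred Q] :
    ∑ β : Orbits N, ∑ p ∈ (orbitModes β).filter Q, f p = ∑ p ∈ Finset.univ.filter Q, f p := by
  rw [← Finset.sum_fiberwise _ (fun p => (Quotient.mk _ p : Orbits N))]
  refine Finset.sum_congr rfl fun β _ => Finset.sum_congr ?_ fun _ _ => rfl
  ext p
  simp [orbitModes, and_comm]

lemma mem_orbitModes {α : Orbits N} {k : lattice N} :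
    k ∈ orbitModes α ↔ (Quotient.mk _ k : Orbits N) = α := by
  simp [orbitModes]

/-- An orbit is contained in the image of the group of signed permutations, of order `3! · 2³`. -/
lemma card_orbitModes_le (α : Orbits N) : (orbitModes α).card ≤ 48 := by
  classical
  obtain ⟨k, rfl⟩ := Quotient.exists_rep α
  let F : Equiv.Perm (Fin 3) × (Fin 3 → ℤˣ) → Fin 3 → ℤ :=
    fun g i => (g.2 i : ℤ) * k.1 (g.1 i)
  have h : (orbitModes (Quotient.mk _ k : Orbits N)).image Subtype.val
      ⊆ Finset.univ.image F := by
    intro l hl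
    obtain ⟨l, hlm, rfl⟩ := Finset.mem_image.1 hl
    rw [mem_orbitModes] at hlm
    have hr : (octahedralSetoid N).r k l := Quotient.exact hlm.symm
    obtain ⟨σ, e, h⟩ := hr
    rw [Finset.mem_image]
    refine ⟨(σ, e), Finset.mem_univ _, ?_⟩
    funext i
    exact (h i).symm
  calc (orbitModes (Quotient.mk _ k : Orbits N)).card
      = ((orbitModes (Quotient.mk _ k : Orbits N)).image Subtype.val).card :=
        (Finset.card_image_of_injective _ Subtype.val_injective).symm
    _ ≤ (Finset.univ.image F).card := Finset.card_le_card h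
    _ ≤ Fintype.card (Equiv.Perm (Fin 3) × (Fin 3 → ℤˣ)) := Finset.card_image_le
    _ = 48 := by
      rw [Fintype.card_prod, Fintype.card_perm, Fintype.card_fun]
      simp [Fintype.card_units_int, Nat.factorial]

lemma orbitModes_card_pos (α : Orbits N) : 0 < (orbitModes α).card := by
  obtain ⟨k, rfl⟩ := Quotient.exists_rep α
  exact Finset.card_pos.2 ⟨k, mem_orbitModes.2 rfl⟩

/-- By `xy ≤ (x² + y²)/2`, two sums of squares remain; injectivity of `e` means that neither counts
a mode twice. -/
lemma sum_amp_mul_le (e : lattice N → Fin 3 → ℤ) (he : Function.Injective e) :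
    ∑ p ∈ Finset.univ.filter (fun p => e p ∈ lattice N), amp u p.1 * amp u (e p)
      ≤ ∑ k ∈ lattice N, amp u k ^ 2 := by
  classical
  have h1 : ∑ p ∈ Finset.univ.filter (fun p : lattice N => e p ∈ lattice N), amp u p.1 ^ 2
      ≤ ∑ k ∈ lattice N, amp u k ^ 2 := by
    rw [← Finset.sum_coe_sort (lattice N) (fun k => amp u k ^ 2)]
    exact Finset.sum_le_sum_of_subset_of_nonneg (Finset.filter_subset _ _)
      fun _ _ _ => sq_nonneg _
  have h2 : ∑ p ∈ Finset.univ.filter (fun p : lattice N => e p ∈ lattice N), amp u (e p) ^ 2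
      ≤ ∑ k ∈ lattice N, amp u k ^ 2 := by
    rw [← Finset.sum_image (f := fun k => amp u k ^ 2) he.injOn]
    refine Finset.sum_le_sum_of_subset_of_nonneg ?_ fun _ _ _ => sq_nonneg _
    intro q hq
    obtain ⟨p, hp, rfl⟩ := Finset.mem_image.1 hq
    exact (Finset.mem_filter.1 hp).2
  calc _ ≤ ∑ p ∈ Finset.univ.filter (fun p => e p ∈ lattice N),
        (amp u p.1 ^ 2 + amp u (e p) ^ 2) / 2 :=
        Finset.sum_le_sum fun p _ => by nlinarith [sq_nonneg (amp u p.1 - amp u (e p))]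
    _ ≤ _ := by
      rw [← Finset.sum_div, Finset.sum_add_distrib]
      linarith

lemma abs_transfer_le (hu : ∀ k ∈ lattice N, toC k ⬝ᵥ u k = 0) (α β : Orbits N) :
    |transfer N u α β| ≤ ((orbitModes α).card : ℝ)⁻¹ * ∑ k ∈ orbitModes α,
      ∑ p ∈ (orbitModes β).filter (fun p => k.1 - p.1 ∈ lattice N),
        2 * (amp u k.1 * amp u p.1 * amp u (k.1 - p.1)) := by
  rw [transfer, Matrix.of_apply, abs_mul, abs_of_nonneg (by positivity)]
  gcongr
  refine (Finset.abs_sum_le_sum_abs _ _).trans (Finset.sum_le_sum fun k _ => ?_)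
  refine (Finset.abs_sum_le_sum_abs _ _).trans (Finset.sum_le_sum fun p _ => ?_)
  exact abs_transfer_term_le u k.1 p.1 (hu _ k.2)

/-- For fixed `k` the sum over all orbits `β` is a sum over all `p`; the factor `amp u k ≤ κ` comes
out, and the average over `Ω_α` costs nothing. -/
lemma sum_abs_transfer_row_le (hu : ∀ k ∈ lattice N, toC k ⬝ᵥ u k = 0) {κ : ℝ}
    (hκ : ∀ k ∈ lattice N, amp u k ≤ κ) (α : Orbits N) :
    ∑ β, |transfer N u α β| ≤ 2 * κ * ∑ k ∈ lattice N, amp u k ^ 2 := by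
  set E := ∑ k ∈ lattice N, amp u k ^ 2
  have hE : 0 ≤ E := Finset.sum_nonneg fun _ _ => sq_nonneg _
  have hc : (0 : ℝ) < (orbitModes α).card := by exact_mod_cast orbitModes_card_pos α
  calc ∑ β, |transfer N u α β|
      ≤ ∑ β, ((orbitModes α).card : ℝ)⁻¹ * ∑ k ∈ orbitModes α,
        ∑ p ∈ (orbitModes β).filter (fun p => k.1 - p.1 ∈ lattice N),
          2 * (amp u k.1 * amp u p.1 * amp u (k.1 - p.1)) :=
        Finset.sum_le_sum fun β _ => abs_transfer_le hu α β
    _ = ((orbitModes α).card : ℝ)⁻¹ * ∑ k ∈ orbitModes α, 2 * amp u k.1 *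
        ∑ p ∈ Finset.univ.filter (fun p : lattice N => k.1 - p.1 ∈ lattice N),
          amp u p.1 * amp u (k.1 - p.1) := by
        rw [← Finset.mul_sum, Finset.sum_comm]
        simp_rw [sum_sum_orbitModes, Finset.mul_sum]
        simp_rw [mul_assoc]
    _ ≤ ((orbitModes α).card : ℝ)⁻¹ * ∑ k ∈ orbitModes α, 2 * κ * E := by
        gcongr with k _
        · exact Finset.sum_nonneg fun _ _ => mul_nonneg (amp_nonneg _ _) (amp_nonneg _ _)
        · exact mul_nonneg zero_le_two ((amp_nonneg u k.1).trans (hκ _ k.2))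
        · exact hκ _ k.2
        · exact sum_amp_mul_le (fun p : lattice N => k.1 - p.1)
            fun p q h => Subtype.ext (sub_right_injective h)
    _ = 2 * κ * E := by
        rw [Finset.sum_const, nsmul_eq_mul]
        field_simp

/-- Now `p` stays in `Ω_α` and `k` runs over the lattice, so `amp u p ≤ κ` comes out. The averaging
weight belongs to the orbit of `k` and is only bounded by 1, which leaves the cardinality of `Ω_α`.
-/
lemma sum_abs_transfer_col_le (hu : ∀ k ∈ lattice N, toC k ⬝ᵥ u k = 0) {κ : ℝ}
    (hκ : ∀ k ∈ lattice N, amp u k ≤ κ) (α : Orbits N) :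
    ∑ β, |transfer N u β α| ≤ (orbitModes α).card * (2 * κ * ∑ k ∈ lattice N, amp u k ^ 2) := by
  set E := ∑ k ∈ lattice N, amp u k ^ 2
  have hE : 0 ≤ E := Finset.sum_nonneg fun _ _ => sq_nonneg _
  have hnn : ∀ k p : lattice N, 0 ≤ 2 * (amp u k.1 * amp u p.1 * amp u (k.1 - p.1)) :=
    fun k p => mul_nonneg zero_le_two
      (mul_nonneg (mul_nonneg (amp_nonneg _ _) (amp_nonneg _ _)) (amp_nonneg _ _))
  calc ∑ β, |transfer N u β α|
      ≤ ∑ β : Orbits N, ∑ k ∈ orbitModes β,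
        ∑ p ∈ (orbitModes α).filter (fun p => k.1 - p.1 ∈ lattice N),
          2 * (amp u k.1 * amp u p.1 * amp u (k.1 - p.1)) := by
        refine Finset.sum_le_sum fun β _ => (abs_transfer_le hu β α).trans ?_
        refine mul_le_of_le_one_left
          (Finset.sum_nonneg fun k _ => Finset.sum_nonneg fun p _ => hnn k p) ?_
        exact inv_le_one_of_one_le₀ (by exact_mod_cast orbitModes_card_pos β)
    _ = ∑ k : lattice N, ∑ p ∈ (orbitModes α).filter (fun p => k.1 - p.1 ∈ lattice N),
          2 * (amp u k.1 * amp u p.1 * amp u (k.1 - p.1)) := by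
        have := sum_sum_orbitModes (N := N) (fun k : lattice N =>
          ∑ p ∈ (orbitModes α).filter (fun p => k.1 - p.1 ∈ lattice N),
          2 * (amp u k.1 * amp u p.1 * amp u (k.1 - p.1))) (fun _ => True)
        simpa only [Finset.filter_true] using this
    _ = ∑ p ∈ orbitModes α, 2 * amp u p.1 *
        ∑ k ∈ Finset.univ.filter (fun k : lattice N => k.1 - p.1 ∈ lattice N),
          amp u k.1 * amp u (k.1 - p.1) := by
        simp_rw [Finset.sum_filter]
        rw [Finset.sum_comm]
        refine Finset.sum_congr rfl fun p _ => ?_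
        rw [Finset.mul_sum]
        refine Finset.sum_congr rfl fun k _ => ?_
        split_ifs <;> ring
    _ ≤ ∑ p ∈ orbitModes α, 2 * κ * E := by
        gcongr with p _
        · exact Finset.sum_nonneg fun _ _ => mul_nonneg (amp_nonneg _ _) (amp_nonneg _ _)
        · exact mul_nonneg zero_le_two ((amp_nonneg u p.1).trans (hκ _ p.2))
        · exact hκ _ p.2
        · exact sum_amp_mul_le (fun k : lattice N => k.1 - p.1)
            fun p q h => Subtype.ext (sub_left_injective h)
    _ = _ := by rw [Finset.sum_const, nsmul_eq_mul]

/-- The deterministic bound: the `ℓ^∞` norm of the stretching matrix of a divergence-free field is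
controlled by its largest enstrophy amplitude. -/
lemma linftyNorm_stretching_le (hu : ∀ k ∈ lattice N, toC k ⬝ᵥ u k = 0) {κ : ℝ} (h0 : 0 ≤ κ)
    (hκ : ∀ k ∈ lattice N, amp u k ≤ κ) (hE : ∑ k ∈ lattice N, amp u k ^ 2 ≤ 2) :
    linftyNorm (stretching N u) ≤ 98 * κ := by
  refine linftyNorm_le (by positivity) fun α => ?_
  have hr := sum_abs_transfer_row_le hu hκ α
  have hc := sum_abs_transfer_col_le hu hκ α
  have hcard : ((orbitModes α).card : ℝ) ≤ 48 := by exact_mod_cast card_orbitModes_le α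
  have hb : 2 * κ * ∑ k ∈ lattice N, amp u k ^ 2 ≤ 4 * κ := by
    nlinarith
  have hb2 : ((orbitModes α).card : ℝ) * (2 * κ * ∑ k ∈ lattice N, amp u k ^ 2)
      ≤ 48 * (4 * κ) := by
    have : 0 ≤ 2 * κ * ∑ k ∈ lattice N, amp u k ^ 2 :=
      mul_nonneg (by positivity) (Finset.sum_nonneg fun _ _ => sq_nonneg _)
    gcongr
  calc ∑ β, |stretching N u α β|
      ≤ ∑ β, (|transfer N u α β| + |transfer N u β α|) / 2 := by
        refine Finset.sum_le_sum fun β _ => ?_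
        rw [stretching, Matrix.of_apply, abs_div, abs_two]
        gcongr
        exact abs_add_le _ _
    -- `98 = (4 + 48 · 4) / 2`, from the row and the column.
    _ ≤ 98 * κ := by
        rw [← Finset.sum_div, Finset.sum_add_distrib]
        linarith

/-! ### Moments of the standard complex Gaussian -/

lemma memLp_coord_gaussian (p : ℝ≥0) :
    MemLp (fun z : ℝ × ℝ => (z.1 : ℂ)) p
        ((gaussianReal 0 (1 / 2)).prod (gaussianReal 0 (1 / 2))) ∧
      MemLp (fun z : ℝ × ℝ => (z.2 : ℂ)) p
        ((gaussianReal 0 (1 / 2)).prod (gaussianReal 0 (1 / 2))) := by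
  have h := memLp_id_gaussianReal (μ := 0) (v := 1 / 2) p
  exact ⟨(h.comp_measurePreserving measurePreserving_fst).ofReal,
    (h.comp_measurePreserving measurePreserving_snd).ofReal⟩

lemma measurable_complex_mk : Measurable (fun z : ℝ × ℝ => (⟨z.1, z.2⟩ : ℂ)) :=
  Complex.measurableEquivRealProd.symm.measurable

lemma complex_mk_eq (z : ℝ × ℝ) : (⟨z.1, z.2⟩ : ℂ) = z.1 + z.2 * Complex.I := by
  apply Complex.ext <;> simp

lemma memLp_id_stdComplexGaussian (p : ℝ≥0) : MemLp id p stdComplexGaussian := by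
  rw [stdComplexGaussian, memLp_map_measure_iff aestronglyMeasurable_id
    measurable_complex_mk.aemeasurable]
  have h := (memLp_coord_gaussian p).1.add ((memLp_coord_gaussian p).2.mul_const Complex.I)
  convert h using 1
  funext z
  exact complex_mk_eq z

lemma integral_id_stdComplexGaussian : ∫ z, z ∂stdComplexGaussian = 0 := by
  rw [stdComplexGaussian, integral_map measurable_complex_mk.aemeasurable
    (by fun_prop)]
  have h1 := memLp_one_iff_integrable.1 (by exact_mod_cast (memLp_coord_gaussian 1).1)
  have h2 := memLp_one_iff_integrable.1 (by exact_mod_cast (memLp_coord_gaussian 1).2)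
  simp_rw [complex_mk_eq]
  rw [integral_add h1 (h2.mul_const _), integral_mul_const,
    integral_fun_fst (fun x : ℝ => (x : ℂ)), integral_fun_snd (fun x : ℝ => (x : ℂ)),
    integral_complex_ofReal]
  simp

lemma integral_sq_gaussianReal : ∫ x, x ^ 2 ∂(gaussianReal 0 (1 / 2)) = 1 / 2 := by
  have h := variance_eq_sub (memLp_id_gaussianReal (μ := 0) (v := 1 / 2) 2)
  rw [variance_id_gaussianReal] at h
  simpa using h.symm

lemma integral_norm_sq_stdComplexGaussian : ∫ z, ‖z‖ ^ 2 ∂stdComplexGaussian = 1 := by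
  rw [stdComplexGaussian, integral_map measurable_complex_mk.aemeasurable
    (by fun_prop)]
  have hi : Integrable (fun x : ℝ => x ^ 2) (gaussianReal 0 (1 / 2)) :=
    (memLp_id_gaussianReal (μ := 0) (v := 1 / 2) 2).integrable_sq
  have e : ∀ z : ℝ × ℝ, ‖(⟨z.1, z.2⟩ : ℂ)‖ ^ 2 = z.1 ^ 2 + z.2 ^ 2 := fun z => by
    rw [← Complex.normSq_eq_norm_sq, Complex.normSq_apply]
    ring
  simp_rw [e]
  rw [integral_add (hi.comp_fst _) (hi.comp_snd _), integral_fun_fst (fun x : ℝ => x ^ 2),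
    integral_fun_snd (fun x : ℝ => x ^ 2), integral_sq_gaussianReal]
  norm_num

/-! ### Moments of a single projected mode -/

/-- The law of a single mode: three independent standard complex Gaussians. -/
noncomputable def modeLaw : Measure (Fin 3 → ℂ) := Measure.pi fun _ => stdComplexGaussian

instance : IsProbabilityMeasure modeLaw := by
  unfold modeLaw
  infer_instance

lemma measurePreserving_coord (i : Fin 3) :
    MeasurePreserving (fun x : Fin 3 → ℂ => x i) modeLaw stdComplexGaussian :=
  measurePreserving_eval _ i

lemma memLp_coord (p : ℝ≥0) (i : Fin 3) : MemLp (fun x : Fin 3 → ℂ => x i) p modeLaw :=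
  (memLp_id_stdComplexGaussian p).comp_measurePreserving (measurePreserving_coord i)

lemma integral_comp_coord {E : Type*} [NormedAddCommGroup E] [NormedSpace ℝ E] (i : Fin 3)
    {f : ℂ → E} (hf : AEStronglyMeasurable f stdComplexGaussian) :
    ∫ x, f (x i) ∂modeLaw = ∫ z, f z ∂stdComplexGaussian := by
  have h := (measurePreserving_coord i).map_eq
  conv_rhs => rw [← h]
  rw [integral_map (measurePreserving_coord i).measurable.aemeasurable (by rwa [h])]

lemma integrable_coord_mul_star (i j : Fin 3) :
    Integrable (fun x : Fin 3 → ℂ => x i * conj (x j)) modeLaw := by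
  have hi : MemLp (fun x : Fin 3 → ℂ => x i) 2 modeLaw := memLp_coord 2 i
  have hj : MemLp (fun x : Fin 3 → ℂ => conj (x j)) 2 modeLaw := (memLp_coord 2 j).star
  exact hi.integrable_mul hj

lemma integral_coord_mul_star (i j : Fin 3) :
    ∫ x, x i * conj (x j) ∂modeLaw = if i = j then 1 else 0 := by
  split_ifs with h
  · subst h
    rw [integral_comp_coord i (f := fun z => z * conj z) (by fun_prop)]
    simp_rw [Complex.mul_conj']
    have := integral_ofReal (𝕜 := ℂ) (f := fun z : ℂ => ‖z‖ ^ 2) (μ := stdComplexGaussian)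
    rw [integral_norm_sq_stdComplexGaussian] at this
    simpa using this
  · have hind : IndepFun (fun x : Fin 3 → ℂ => x i) (fun x => x j) modeLaw :=
      (iIndepFun_pi (μ := fun _ : Fin 3 => stdComplexGaussian) (X := fun _ z => z)
        fun _ => aemeasurable_id).indepFun h
    have hind' := hind.comp (φ := id) (ψ := fun z : ℂ => conj z) measurable_id (by fun_prop)
    have := hind'.integral_fun_mul_eq_mul_integral
      (by exact (measurable_pi_apply i).aestronglyMeasurable)
      (by exact (Measurable.comp (by fun_prop) (measurable_pi_apply j)).aestronglyMeasurable)
    refine Eq.trans this ?_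
    have h0 : ∫ x, x i ∂modeLaw = 0 := by
      rw [integral_comp_coord i (f := fun z => z) (by fun_prop), integral_id_stdComplexGaussian]
    exact mul_eq_zero_of_left h0 _

lemma integral_norm_dotProduct_sq (k : Fin 3 → ℤ) :
    ∫ x, ‖toC k ⬝ᵥ x‖ ^ 2 ∂modeLaw = normSq k := by
  have e : ∀ x : Fin 3 → ℂ, ((‖toC k ⬝ᵥ x‖ ^ 2 : ℝ) : ℂ)
      = ∑ i, ∑ j, ((k i : ℂ) * (k j : ℂ)) * (x i * conj (x j)) := by
    intro x
    rw [Complex.ofReal_pow, ← Complex.mul_conj', dotProduct, map_sum, Finset.sum_mul_sum]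
    refine Finset.sum_congr rfl fun i _ => Finset.sum_congr rfl fun j _ => ?_
    simp [toC]
    ring
  have h : ((∫ x, ‖toC k ⬝ᵥ x‖ ^ 2 ∂modeLaw : ℝ) : ℂ) = (normSq k : ℂ) := by
    rw [← integral_complex_ofReal]
    simp_rw [e]
    rw [integral_finsetSum _ fun i _ => integrable_finsetSum _ fun j _ =>
      (integrable_coord_mul_star i j).const_mul _]
    simp_rw [integral_finsetSum _ fun j _ => (integrable_coord_mul_star _ j).const_mul _,
      integral_const_mul, integral_coord_mul_star]
    simp [normSq, pow_two]
  exact_mod_cast h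

lemma measurable_sqNorm : Measurable sqNorm := by
  unfold sqNorm
  fun_prop

lemma measurable_sqNorm_leray (k : Fin 3 → ℤ) :
    Measurable fun x => sqNorm (leray k *ᵥ x) := by
  refine measurable_sqNorm.comp ?_
  unfold Matrix.mulVec dotProduct
  fun_prop

lemma integrable_norm_coord_sq (i : Fin 3) :
    Integrable (fun x : Fin 3 → ℂ => ‖x i‖ ^ 2) modeLaw :=
  (memLp_coord 2 i).norm.integrable_sq

lemma integrable_sqNorm : Integrable sqNorm modeLaw :=
  integrable_finsetSum _ fun i _ => integrable_norm_coord_sq i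

lemma integral_sqNorm : ∫ x, sqNorm x ∂modeLaw = 3 := by
  unfold sqNorm
  rw [integral_finsetSum _ fun i _ => integrable_norm_coord_sq i]
  simp_rw [integral_comp_coord _ (f := fun z => ‖z‖ ^ 2) (by fun_prop),
    integral_norm_sq_stdComplexGaussian]
  simp

/-- `∑ |x_i|² ≤ (∑ |x_i|)²`, and the sum of moduli has moments of every order. The powers 2 and 3
are used later. -/
lemma integrable_sqNorm_pow (n : ℕ) : Integrable (fun x => sqNorm x ^ n) modeLaw := by
  have hS : MemLp (fun x : Fin 3 → ℂ => ∑ i, ‖x i‖) (2 * n : ℕ) modeLaw :=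
    memLp_finsetSum _ fun i _ => by exact_mod_cast (memLp_coord ((2 * n : ℕ) : ℝ≥0) i).norm
  refine (hS.integrable_norm_pow').mono' (measurable_sqNorm.pow_const n).aestronglyMeasurable
    (Eventually.of_forall fun x => ?_)
  have h0 : 0 ≤ ∑ i, ‖x i‖ := Finset.sum_nonneg fun _ _ => norm_nonneg _
  rw [Real.norm_of_nonneg (pow_nonneg (sqNorm_nonneg x) n), Real.norm_of_nonneg h0, pow_mul]
  refine pow_le_pow_left₀ (sqNorm_nonneg x) ?_ n
  exact Finset.sum_sq_le_sq_sum_of_nonneg fun _ _ => norm_nonneg _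

lemma memLp_sqNorm : MemLp sqNorm 2 modeLaw :=
  (memLp_two_iff_integrable_sq measurable_sqNorm.aestronglyMeasurable).2 (integrable_sqNorm_pow 2)

lemma memLp_sqNorm_leray {k : Fin 3 → ℤ} (hk : k ≠ 0) :
    MemLp (fun x => sqNorm (leray k *ᵥ x)) 2 modeLaw :=
  memLp_sqNorm.mono (measurable_sqNorm_leray k).aestronglyMeasurable
    (Eventually.of_forall fun x => by
      rw [Real.norm_of_nonneg (sqNorm_nonneg _), Real.norm_of_nonneg (sqNorm_nonneg _)]
      exact sqNorm_leray_mulVec_le hk x)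

/-- A projected Gaussian mode has mean energy `tr P(k) = 2`. -/
lemma integral_sqNorm_leray {k : Fin 3 → ℤ} (hk : k ≠ 0) :
    ∫ x, sqNorm (leray k *ᵥ x) ∂modeLaw = 2 := by
  have h0 : normSq k ≠ 0 := by
    have := one_le_normSq hk
    linarith
  have hd : MemLp (fun x : Fin 3 → ℂ => toC k ⬝ᵥ x) 2 modeLaw :=
    memLp_finsetSum _ fun i _ => (memLp_coord 2 i).const_mul _
  simp_rw [sqNorm_leray_mulVec hk]
  rw [integral_sub integrable_sqNorm (hd.norm.integrable_sq.const_mul _), integral_sqNorm,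
    integral_const_mul, integral_norm_dotProduct_sq, inv_mul_cancel₀ h0]
  norm_num

lemma variance_sqNorm_leray_le {k : Fin 3 → ℤ} (hk : k ≠ 0) :
    Var[fun x => sqNorm (leray k *ᵥ x); modeLaw] ≤ ∫ x, sqNorm x ^ 2 ∂modeLaw := by
  refine (variance_le_expectation_sq (measurable_sqNorm_leray k).aestronglyMeasurable).trans ?_
  refine integral_mono (memLp_sqNorm_leray hk).integrable_sq (integrable_sqNorm_pow 2) fun x => ?_
  exact pow_le_pow_left₀ (sqNorm_nonneg _) (sqNorm_leray_mulVec_le hk x) 2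

/-! ### Concentration of the energy of the large modes -/

lemma measurePreserving_mode (k : halfLattice N) :
    MeasurePreserving (fun X : Coords N => X k) (ensemble N) modeLaw :=
  measurePreserving_eval (fun _ => modeLaw) k

lemma integral_comp_mode (k : halfLattice N) {f : (Fin 3 → ℂ) → ℝ} (hf : Measurable f) :
    ∫ X, f (X k) ∂(ensemble N) = ∫ x, f x ∂modeLaw := by
  rw [← (measurePreserving_mode k).map_eq,
    integral_map (measurePreserving_mode k).measurable.aemeasurable hf.aestronglyMeasurable]

lemma halfLattice_subset : halfLattice N ⊆ lattice N := Finset.filter_subset _ _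

lemma ne_zero_of_mem_lattice {k : Fin 3 → ℤ} (hk : k ∈ lattice N) : k ≠ 0 :=
  Finset.ne_of_mem_erase hk

/-- The modes of the half-lattice of size comparable to `N`. -/
noncomputable def largeModes (N : ℕ) : Finset (halfLattice N) :=
  Finset.univ.filter fun k => (N : ℤ) ≤ 2 * k.1 0

/-- The energy `∑ |P(k) X_k|²` of the projected Gaussians over the large modes. -/
noncomputable def bulk (N : ℕ) (X : Coords N) : ℝ :=
  ∑ k ∈ largeModes N, sqNorm (leray k.1 *ᵥ X k)

lemma memLp_bulk_summand (k : halfLattice N) :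
    MemLp (fun X : Coords N => sqNorm (leray k.1 *ᵥ X k)) 2 (ensemble N) :=
  (memLp_sqNorm_leray (ne_zero_of_mem_lattice (halfLattice_subset k.2))).comp_measurePreserving
    (measurePreserving_mode k)

lemma memLp_bulk : MemLp (bulk N) 2 (ensemble N) :=
  memLp_finsetSum _ fun k _ => memLp_bulk_summand k

lemma integral_bulk : ∫ X, bulk N X ∂(ensemble N) = 2 * (largeModes N).card := by
  unfold bulk
  rw [integral_finsetSum _ fun k _ => (memLp_bulk_summand k).integrable one_le_two]
  rw [Finset.sum_congr rfl fun k _ => (integral_comp_mode k (measurable_sqNorm_leray k.1)).trans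
    (integral_sqNorm_leray (ne_zero_of_mem_lattice (halfLattice_subset k.2)))]
  rw [Finset.sum_const, nsmul_eq_mul, mul_comm]

lemma iIndepFun_bulk_summand :
    iIndepFun (fun (k : halfLattice N) (X : Coords N) => sqNorm (leray k.1 *ᵥ X k))
      (ensemble N) :=
  iIndepFun_pi (μ := fun _ : halfLattice N => modeLaw) (X := fun k x => sqNorm (leray k.1 *ᵥ x))
    fun k => (measurable_sqNorm_leray k.1).aemeasurable

lemma bulk_eq_sum :
    bulk N = ∑ k ∈ largeModes N, fun X : Coords N => sqNorm (leray k.1 *ᵥ X k) := by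
  funext X
  rw [Finset.sum_apply]
  rfl

lemma variance_bulk_summand_le (k : halfLattice N) :
    Var[fun X : Coords N => sqNorm (leray k.1 *ᵥ X k); ensemble N]
      ≤ ∫ x, sqNorm x ^ 2 ∂modeLaw :=
  ((measurePreserving_mode k).variance_fun_comp
    (measurable_sqNorm_leray k.1).aemeasurable).trans_le
    (variance_sqNorm_leray_le (ne_zero_of_mem_lattice (halfLattice_subset k.2)))

/-- The modes of the half-lattice are independent, so variances add; each is bounded uniformly in
`k` because the projector contracts. -/
lemma variance_bulk_le :
    Var[bulk N; ensemble N] ≤ (largeModes N).card * ∫ x, sqNorm x ^ 2 ∂modeLaw := by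
  rw [bulk_eq_sum, IndepFun.variance_sum (fun k _ => memLp_bulk_summand k)
    fun i _ j _ hij => iIndepFun_bulk_summand.indepFun hij, ← nsmul_eq_mul]
  exact Finset.sum_le_card_nsmul _ _ _ fun k _ => variance_bulk_summand_le k

lemma integral_bulk_sub_sq_le :
    ∫ X, (bulk N X - 2 * (largeModes N).card) ^ 2 ∂(ensemble N)
      ≤ (largeModes N).card * ∫ x, sqNorm x ^ 2 ∂modeLaw := by
  rw [← integral_bulk, ← variance_eq_integral memLp_bulk.aestronglyMeasurable.aemeasurable]
  exact variance_bulk_le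

lemma cube_le_card_largeModes (hN : 1 ≤ N) : N ^ 3 ≤ (largeModes N).card := by
  -- `(N + 1) / 2` is `N / 2` rounded up: positive for `N ≥ 1`, so the box lies in the half-lattice
  -- by the sign of its first coordinate alone.
  let T : Finset (Fin 3 → ℤ) := Fintype.piFinset
    ![Finset.Icc (((N + 1) / 2 : ℕ) : ℤ) N, Finset.Icc (-(N : ℤ)) N, Finset.Icc (-(N : ℤ)) N]
  have hT : T ⊆ (largeModes N).image Subtype.val := by
    intro k hk
    have hk' := Fintype.mem_piFinset.1 hk
    have h0 := Finset.mem_Icc.1 (hk' 0)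
    have h1 := Finset.mem_Icc.1 (hk' 1)
    have h2 := Finset.mem_Icc.1 (hk' 2)
    have hpos : 0 < k 0 := by have := h0.1; dsimp at this; omega
    have hbig : (N : ℤ) ≤ 2 * k 0 := by have := h0.1; dsimp at this; omega
    have hmem : k ∈ halfLattice N := by
      refine Finset.mem_filter.2 ⟨Finset.mem_erase.2 ⟨fun h => ?_, ?_⟩, Or.inl hpos⟩
      · rw [h] at hpos
        exact lt_irrefl _ hpos
      · refine Fintype.mem_piFinset.2 fun i => Finset.mem_Icc.2 ?_
        fin_cases i
        · exact ⟨by have := h0.1; dsimp at this ⊢; omega, h0.2⟩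
        · exact h1
        · exact h2
    exact Finset.mem_image.2 ⟨⟨k, hmem⟩, Finset.mem_filter.2 ⟨Finset.mem_univ _, hbig⟩, rfl⟩
  have hcard : T.card = (N + 1 - (N + 1) / 2) * ((2 * N + 1) * (2 * N + 1)) := by
    rw [Fintype.card_piFinset, Fin.prod_univ_three]
    simp only [Matrix.cons_val, Int.card_Icc]
    have e1 : ((N : ℤ) + 1 - (((N + 1) / 2 : ℕ) : ℤ)).toNat = N + 1 - (N + 1) / 2 := by omega
    have e2 : ((N : ℤ) + 1 - -(N : ℤ)).toNat = 2 * N + 1 := by omega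
    rw [e1, e2, mul_assoc]
  have hle : T.card ≤ (largeModes N).card :=
    (Finset.card_le_card hT).trans Finset.card_image_le
  have hhalf : N ≤ 2 * (N + 1 - (N + 1) / 2) := by omega
  refine le_trans ?_ (hcard ▸ hle)
  set a := N + 1 - (N + 1) / 2
  have hsq : 2 * N ^ 2 ≤ (2 * N + 1) * (2 * N + 1) := by nlinarith
  calc N ^ 3 = N * N ^ 2 := by ring
    _ ≤ (2 * a) * N ^ 2 := by gcongr
    _ = a * (2 * N ^ 2) := by ring
    _ ≤ _ := by gcongr

lemma card_halfLattice_le : (halfLattice N).card ≤ (2 * N + 1) ^ 3 := by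
  calc (halfLattice N).card
      ≤ (Fintype.piFinset fun _ : Fin 3 => Finset.Icc (-(N : ℤ)) (N : ℤ)).card :=
        Finset.card_le_card (halfLattice_subset.trans (Finset.erase_subset _ _))
    _ = (2 * N + 1) ^ 3 := by
      rw [Fintype.card_piFinset, Finset.prod_const, Int.card_Icc]
      have e2 : ((N : ℤ) + 1 - -(N : ℤ)).toNat = 2 * N + 1 := by omega
      rw [e2]
      simp

/-! ### Comparing the normalized amplitudes with the bulk energy -/

variable {s : ℕ}

lemma rawField_eq (X : Coords N) (k : Fin 3 → ℤ) :
    rawField s X k = (((√(normSq k) ^ s)⁻¹ : ℝ) : ℂ) • (leray k *ᵥ extend X k) := rfl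

lemma field_eq (X : Coords N) (k : Fin 3 → ℤ) :
    field s X k = (((√(energy N (rawField s X)))⁻¹ : ℝ) : ℂ) • rawField s X k := rfl

lemma toC_dotProduct_field (X : Coords N) {k : Fin 3 → ℤ} (hk : k ≠ 0) :
    toC k ⬝ᵥ field s X k = 0 := by
  rw [field_eq, rawField_eq, dotProduct_smul, dotProduct_smul, toC_dotProduct_leray_mulVec hk]
  simp

lemma energy_eq (v : (Fin 3 → ℤ) → Fin 3 → ℂ) :
    energy N v = (1 / 2) * ∑ k ∈ lattice N, amp v k ^ 2 := by
  simp_rw [amp_sq]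
  rfl

lemma energy_nonneg (v : (Fin 3 → ℤ) → Fin 3 → ℂ) : 0 ≤ energy N v := by
  rw [energy_eq]
  have : 0 ≤ ∑ k ∈ lattice N, amp v k ^ 2 := Finset.sum_nonneg fun _ _ => sq_nonneg _
  linarith

lemma amp_field_sq (X : Coords N) (k : Fin 3 → ℤ) :
    amp (field s X) k ^ 2 = (energy N (rawField s X))⁻¹ * amp (rawField s X) k ^ 2 := by
  rw [amp_sq, amp_sq, field_eq, sqNorm_real_smul, inv_pow, Real.sq_sqrt (energy_nonneg _)]
  ring

lemma sum_amp_field_sq_le (X : Coords N) : ∑ k ∈ lattice N, amp (field s X) k ^ 2 ≤ 2 := by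
  simp_rw [amp_field_sq]
  rw [← Finset.mul_sum]
  have h : ∑ k ∈ lattice N, amp (rawField s X) k ^ 2 = 2 * energy N (rawField s X) := by
    rw [energy_eq]; ring
  rw [h]
  -- At zero energy the inverse is 0 and the normalized field vanishes; hence an inequality rather
  -- than an equality.
  rcases eq_or_ne (energy N (rawField s X)) 0 with h0 | h0
  · rw [h0]; norm_num
  · exact le_of_eq (by field_simp)

lemma amp_rawField_sq (X : Coords N) (k : Fin 3 → ℤ) :
    amp (rawField s X) k ^ 2
      = normSq k * (normSq k ^ s)⁻¹ * sqNorm (leray k *ᵥ extend X k) := by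
  rw [amp_sq, rawField_eq, sqNorm_real_smul, inv_pow, ← pow_mul, mul_comm s 2, pow_mul,
    Real.sq_sqrt (normSq_nonneg k), mul_assoc]

lemma normSq_le_of_mem_lattice {k : Fin 3 → ℤ} (hk : k ∈ lattice N) :
    normSq k ≤ 3 * (N : ℝ) ^ 2 := by
  have h : ∀ i, ((k i : ℝ)) ^ 2 ≤ (N : ℝ) ^ 2 := by
    intro i
    have hi := Finset.mem_Icc.1 (Fintype.mem_piFinset.1 (Finset.mem_of_mem_erase hk) i)
    have h1 : -(N : ℝ) ≤ (k i : ℝ) := by exact_mod_cast hi.1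
    have h2 : (k i : ℝ) ≤ (N : ℝ) := by exact_mod_cast hi.2
    exact sq_le_sq' h1 h2
  calc normSq k ≤ ∑ _i : Fin 3, (N : ℝ) ^ 2 := Finset.sum_le_sum fun i _ => h i
    _ = 3 * (N : ℝ) ^ 2 := by simp

lemma sq_le_normSq_of_mem_largeModes {k : halfLattice N} (hk : k ∈ largeModes N) :
    (N : ℝ) ^ 2 ≤ 4 * normSq k.1 := by
  have h : (N : ℤ) ≤ 2 * k.1 0 := (Finset.mem_filter.1 hk).2
  have h' : (N : ℝ) ≤ 2 * (k.1 0 : ℝ) := by exact_mod_cast h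
  have h0 : (k.1 0 : ℝ) ^ 2 ≤ normSq k.1 :=
    Finset.single_le_sum (f := fun i => (k.1 i : ℝ) ^ 2) (fun _ _ => sq_nonneg _)
      (Finset.mem_univ 0)
  have : (N : ℝ) ^ 2 ≤ (2 * (k.1 0 : ℝ)) ^ 2 := pow_le_pow_left₀ (Nat.cast_nonneg _) h' 2
  linarith

lemma extend_of_mem (X : Coords N) (k : halfLattice N) : extend X k.1 = X k := by
  simp [extend]

/-- The weight `|k|^{2-2s}` of a mode is at most twelve times that of any large mode. -/
lemma weight_le (hs : s ≤ 1) {k : Fin 3 → ℤ} (hk : k ∈ lattice N) {j : halfLattice N}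
    (hj : j ∈ largeModes N) :
    normSq k * (normSq k ^ s)⁻¹ ≤ 12 * (normSq j.1 * (normSq j.1 ^ s)⁻¹) := by
  have h1 := normSq_le_of_mem_lattice hk
  have h2 := sq_le_normSq_of_mem_largeModes hj
  -- For `s = 0`, `|k|² ≤ 3N² ≤ 12|j|²`; for `s = 1` both weights equal 1.
  interval_cases s
  · simp only [pow_zero, inv_one, mul_one]
    linarith
  · have hk0 := one_le_normSq (ne_zero_of_mem_lattice hk)
    have hj0 := one_le_normSq (ne_zero_of_mem_lattice (halfLattice_subset j.2))
    rw [pow_one, pow_one, mul_inv_cancel₀ (by linarith), mul_inv_cancel₀ (by linarith)]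
    norm_num

/-- Comparable weights let the large modes bound the energy from below; `24 = 12 · 2`, the 2 undoing
the half in the energy. The product form needs no positivity of `bulk`. -/
lemma amp_field_sq_mul_bulk_le (hs : s ≤ 1) (X : Coords N) {k : Fin 3 → ℤ}
    (hk : k ∈ lattice N) :
    amp (field s X) k ^ 2 * bulk N X ≤ 24 * sqNorm (leray k *ᵥ extend X k) := by
  set y := sqNorm (leray k *ᵥ extend X k) with hy
  have hy0 : 0 ≤ y := sqNorm_nonneg _
  have h1 : ∀ j ∈ largeModes N, amp (rawField s X) k ^ 2 * sqNorm (leray j.1 *ᵥ X j)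
      ≤ 12 * y * amp (rawField s X) j.1 ^ 2 := by
    intro j hj
    rw [amp_rawField_sq, amp_rawField_sq, extend_of_mem, ← hy]
    have hw := weight_le hs hk hj
    have hnn : 0 ≤ y * sqNorm (leray j.1 *ᵥ X j) := mul_nonneg hy0 (sqNorm_nonneg _)
    have := mul_le_mul_of_nonneg_right hw hnn
    linarith
  have h2 : ∑ j ∈ largeModes N, amp (rawField s X) j.1 ^ 2 ≤ 2 * energy N (rawField s X) := by
    rw [energy_eq, ← Finset.sum_image (f := fun k => amp (rawField s X) k ^ 2)
      Subtype.val_injective.injOn]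
    have : ∑ k ∈ (largeModes N).image Subtype.val, amp (rawField s X) k ^ 2
        ≤ ∑ k ∈ lattice N, amp (rawField s X) k ^ 2 := by
      refine Finset.sum_le_sum_of_subset_of_nonneg ?_ fun _ _ _ => sq_nonneg _
      intro l hl
      obtain ⟨j, _, rfl⟩ := Finset.mem_image.1 hl
      exact halfLattice_subset j.2
    linarith
  have h3 : amp (rawField s X) k ^ 2 * bulk N X ≤ 24 * y * energy N (rawField s X) := by
    rw [bulk, Finset.mul_sum]
    refine (Finset.sum_le_sum h1).trans ?_
    rw [← Finset.mul_sum]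
    have := mul_le_mul_of_nonneg_left h2 (by positivity : 0 ≤ 12 * y)
    linarith
  rw [amp_field_sq, mul_assoc]
  rcases (energy_nonneg (N := N) (rawField s X)).eq_or_lt with h0 | h0
  · rw [← h0, inv_zero, zero_mul]
    positivity
  · rw [inv_mul_le_iff₀ h0]
    linarith

/-- Replaces a maximum over modes by a sum. The cube makes this affordable: after division by `N²`
the sum of about `N³` terms has mean `O(N)`. -/
lemma sqNorm_extend_pow_le (X : Coords N) (k : Fin 3 → ℤ) :
    sqNorm (extend X k) ^ 3 ≤ ∑ j, sqNorm (X j) ^ 3 := by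
  have hnn : ∀ j ∈ Finset.univ, 0 ≤ sqNorm (X j) ^ 3 := fun j _ => pow_nonneg (sqNorm_nonneg _) 3
  unfold extend
  split_ifs with h1 h2
  · exact Finset.single_le_sum (f := fun j => sqNorm (X j) ^ 3) hnn
      (Finset.mem_univ (⟨k, h1⟩ : halfLattice N))
  · rw [sqNorm_star]
    exact Finset.single_le_sum (f := fun j => sqNorm (X j) ^ 3) hnn
      (Finset.mem_univ (⟨-k, h2⟩ : halfLattice N))
  · have : sqNorm 0 = 0 := by simp [sqNorm]
    rw [this]
    simpa using Finset.sum_nonneg hnn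

/-! ### The majorant and its expectation -/

/-- A polynomial majorant of the squared amplitudes of the normalized field. -/
noncomputable def majorant (N : ℕ) (X : Coords N) : ℝ :=
  2 * ((((largeModes N).card : ℝ) ^ 2)⁻¹ * (bulk N X - 2 * (largeModes N).card) ^ 2) +
    24 * (((largeModes N).card : ℝ)⁻¹ * (N + ((N : ℝ) ^ 2)⁻¹ * ∑ j, sqNorm (X j) ^ 3))

lemma majorant_nonneg (X : Coords N) : 0 ≤ majorant N X := by
  have : 0 ≤ ∑ j, sqNorm (X j) ^ 3 :=
    Finset.sum_nonneg fun j _ => pow_nonneg (sqNorm_nonneg _) 3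
  unfold majorant
  positivity

/-- If `a ≤ 2` and `a b ≤ 24 y`, then `a` is small unless `b` is far from `2 n` or `y` is large. -/
lemma le_of_mul_le_of_le_two {a b n m y Z : ℝ} (ha : 0 ≤ a) (ha2 : a ≤ 2) (hn : 0 < n)
    (hm : 0 < m) (hy : 0 ≤ y) (hyZ : y ^ 3 ≤ Z) (hab : a * b ≤ 24 * y) :
    a ≤ 2 * ((n ^ 2)⁻¹ * (b - 2 * n) ^ 2) + 24 * (n⁻¹ * (m + (m ^ 2)⁻¹ * Z)) := by
  have hZ : 0 ≤ Z := (pow_nonneg hy 3).trans hyZ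
  -- The threshold `n` is half the mean `2 n`; below it `(b - 2n)² ≥ n²`, so the first term already
  -- exceeds 2.
  rcases lt_or_ge b n with h | h
  · have h2 : 1 ≤ (n ^ 2)⁻¹ * (b - 2 * n) ^ 2 := by
      rw [le_inv_mul_iff₀ (by positivity)]
      nlinarith
    have h3 : 0 ≤ 24 * (n⁻¹ * (m + (m ^ 2)⁻¹ * Z)) := by positivity
    linarith
  · have hyb : y ≤ m + (m ^ 2)⁻¹ * Z := by
      -- Truncation at `m`: above it, `y ≤ y³ / m²`.
      rcases le_total y m with hym | hym
      · have : 0 ≤ (m ^ 2)⁻¹ * Z := by positivity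
        linarith
      · have : y ≤ (m ^ 2)⁻¹ * Z := by
          rw [le_inv_mul_iff₀ (by positivity)]
          refine le_trans ?_ hyZ
          calc m ^ 2 * y ≤ y ^ 2 * y := by gcongr
            _ = y ^ 3 := by ring
        linarith
    have h2 : a * n ≤ 24 * y := (mul_le_mul_of_nonneg_left h ha).trans hab
    have h3 : a ≤ 24 * (n⁻¹ * y) := by
      have : 24 * (n⁻¹ * y) = (24 * y) / n := by field_simp
      rw [this, le_div_iff₀ hn]
      exact h2
    have h4 : n⁻¹ * y ≤ n⁻¹ * (m + (m ^ 2)⁻¹ * Z) := by gcongr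
    have h5 : 0 ≤ 2 * ((n ^ 2)⁻¹ * (b - 2 * n) ^ 2) := by positivity
    linarith

lemma amp_field_sq_le (hs : s ≤ 1) (hN : 1 ≤ N) (X : Coords N) {k : Fin 3 → ℤ}
    (hk : k ∈ lattice N) : amp (field s X) k ^ 2 ≤ majorant N X := by
  have hn : (0 : ℝ) < (largeModes N).card := by
    exact_mod_cast (pow_pos hN 3).trans_le (cube_le_card_largeModes hN)
  have h1 : amp (field s X) k ^ 2 ≤ 2 :=
    (Finset.single_le_sum (f := fun k => amp (field s X) k ^ 2) (fun _ _ => sq_nonneg _)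
      hk).trans (sum_amp_field_sq_le X)
  have hyx := sqNorm_leray_mulVec_le (ne_zero_of_mem_lattice hk) (extend X k)
  exact le_of_mul_le_of_le_two (sq_nonneg _) h1 hn (by exact_mod_cast hN) (sqNorm_nonneg _)
    ((pow_le_pow_left₀ (sqNorm_nonneg _) hyx 3).trans (sqNorm_extend_pow_le X k))
    (amp_field_sq_mul_bulk_le hs X hk)

lemma linftyNorm_V_le (hs : s ≤ 1) (hN : 1 ≤ N) (X : Coords N) :
    linftyNorm (V s N X) ≤ 98 * √(majorant N X) :=
  linftyNorm_stretching_le (fun _ hk => toC_dotProduct_field X (ne_zero_of_mem_lattice hk))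
    (Real.sqrt_nonneg _) (fun _ hk => Real.le_sqrt_of_sq_le (amp_field_sq_le hs hN X hk))
    (sum_amp_field_sq_le X)

lemma linftyNorm_V_sq_le (hs : s ≤ 1) (hN : 1 ≤ N) (X : Coords N) :
    linftyNorm (V s N X) ^ 2 ≤ 9604 * majorant N X := by
  have h := pow_le_pow_left₀ (linftyNorm_nonneg _) (linftyNorm_V_le hs hN X) 2
  rw [mul_pow, Real.sq_sqrt (majorant_nonneg X)] at h
  linarith

lemma integrable_sqNorm_mode_pow (j : halfLattice N) :
    Integrable (fun X : Coords N => sqNorm (X j) ^ 3) (ensemble N) :=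
  (measurePreserving_mode j).integrable_comp_of_integrable (integrable_sqNorm_pow 3)

lemma integrable_bulk_sub_sq :
    Integrable (fun X => (bulk N X - 2 * (largeModes N).card) ^ 2) (ensemble N) :=
  (memLp_bulk.sub (memLp_const _)).integrable_sq

lemma integrable_sum_sqNorm_mode_pow :
    Integrable (fun X : Coords N => ∑ j, sqNorm (X j) ^ 3) (ensemble N) :=
  integrable_finsetSum _ fun j _ => integrable_sqNorm_mode_pow j

lemma integrable_add_sum_sqNorm_mode_pow :
    Integrable (fun X : Coords N => (N : ℝ) + ((N : ℝ) ^ 2)⁻¹ * ∑ j, sqNorm (X j) ^ 3)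
      (ensemble N) :=
  (integrable_const _).add (integrable_sum_sqNorm_mode_pow.const_mul _)

lemma integrable_majorant : Integrable (majorant N) (ensemble N) :=
  ((integrable_bulk_sub_sq.const_mul _).const_mul _).add
    ((integrable_add_sum_sqNorm_mode_pow.const_mul _).const_mul _)

/-- The constant in the second-moment bound. -/
noncomputable def momentConst : ℝ :=
  2 * (∫ x, sqNorm x ^ 2 ∂modeLaw) + 24 * (1 + 27 * ∫ x, sqNorm x ^ 3 ∂modeLaw)

lemma momentConst_pos : 0 < momentConst := by
  have h2 : 0 ≤ ∫ x, sqNorm x ^ 2 ∂modeLaw := integral_nonneg fun x => sq_nonneg _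
  have h3 : 0 ≤ ∫ x, sqNorm x ^ 3 ∂modeLaw :=
    integral_nonneg fun x => pow_nonneg (sqNorm_nonneg x) 3
  unfold momentConst
  linarith

lemma integral_majorant_le (hN : 1 ≤ N) :
    ∫ X, majorant N X ∂(ensemble N) ≤ momentConst * ((N : ℝ) ^ 2)⁻¹ := by
  have hNr : (1 : ℝ) ≤ N := by exact_mod_cast hN
  have hn3 : (N : ℝ) ^ 3 ≤ (largeModes N).card := by exact_mod_cast cube_le_card_largeModes hN
  have hn : (0 : ℝ) < (largeModes N).card := lt_of_lt_of_le (by positivity) hn3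
  have h2 : 0 ≤ ∫ x, sqNorm x ^ 2 ∂modeLaw := integral_nonneg fun x => sq_nonneg _
  have h3 : 0 ≤ ∫ x, sqNorm x ^ 3 ∂modeLaw :=
    integral_nonneg fun x => pow_nonneg (sqNorm_nonneg x) 3
  have hcard : ((halfLattice N).card : ℝ) ≤ 27 * (N : ℝ) ^ 3 := by
    have h : ((halfLattice N).card : ℝ) ≤ (2 * (N : ℝ) + 1) ^ 3 := by
      exact_mod_cast card_halfLattice_le (N := N)
    refine h.trans ?_
    calc (2 * (N : ℝ) + 1) ^ 3 ≤ (3 * (N : ℝ)) ^ 3 := by gcongr; linarith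
      _ = 27 * (N : ℝ) ^ 3 := by ring
  have hint : ∫ X, majorant N X ∂(ensemble N)
      = 2 * ((((largeModes N).card : ℝ) ^ 2)⁻¹ *
          ∫ X, (bulk N X - 2 * (largeModes N).card) ^ 2 ∂(ensemble N)) +
        24 * (((largeModes N).card : ℝ)⁻¹ * (N + ((N : ℝ) ^ 2)⁻¹ *
          ((halfLattice N).card * ∫ x, sqNorm x ^ 3 ∂modeLaw))) := by
    unfold majorant
    rw [integral_add ((integrable_bulk_sub_sq.const_mul _).const_mul _)
      ((integrable_add_sum_sqNorm_mode_pow.const_mul _).const_mul _),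
      integral_const_mul, integral_const_mul, integral_const_mul, integral_const_mul,
      integral_add (integrable_const _) (integrable_sum_sqNorm_mode_pow.const_mul _),
      integral_const_mul, integral_finsetSum _ fun j _ => integrable_sqNorm_mode_pow j,
      Finset.sum_congr rfl fun j _ => integral_comp_mode j (measurable_sqNorm.pow_const 3)]
    simp
  have hb := integral_bulk_sub_sq_le (N := N)
  rw [hint]
  unfold momentConst
  set n : ℝ := ((largeModes N).card : ℝ)
  set A := ∫ x, sqNorm x ^ 2 ∂modeLaw
  set B := ∫ x, sqNorm x ^ 3 ∂modeLaw
  have t1 : (n ^ 2)⁻¹ * ∫ X, (bulk N X - 2 * n) ^ 2 ∂(ensemble N) ≤ A * ((N : ℝ) ^ 2)⁻¹ := by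
    calc _ ≤ (n ^ 2)⁻¹ * (n * A) := by gcongr
      _ = A * n⁻¹ := by field_simp
      _ ≤ A * ((N : ℝ) ^ 2)⁻¹ := by
        gcongr
        exact (pow_le_pow_right₀ hNr (by norm_num : 2 ≤ 3)).trans hn3
  have t2 : n⁻¹ * (N + ((N : ℝ) ^ 2)⁻¹ * ((halfLattice N).card * B))
      ≤ (1 + 27 * B) * ((N : ℝ) ^ 2)⁻¹ := by
    -- The truncation level `N` balances the two terms: both are of order `N` inside the
    -- parentheses.
    calc _ ≤ ((N : ℝ) ^ 3)⁻¹ * (N + ((N : ℝ) ^ 2)⁻¹ * (27 * (N : ℝ) ^ 3 * B)) := by gcongr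
      _ = _ := by field_simp
  linarith

/-! ### Measurability -/

lemma measurable_extend (k : Fin 3 → ℤ) (i : Fin 3) :
    Measurable fun X : Coords N => extend X k i := by
  unfold extend
  split_ifs
  · fun_prop
  · simp only [Pi.star_apply]
    fun_prop
  · exact measurable_const

lemma measurable_rawField (k : Fin 3 → ℤ) (i : Fin 3) :
    Measurable fun X : Coords N => rawField s X k i := by
  simp only [rawField_eq, Pi.smul_apply, Matrix.mulVec, dotProduct, smul_eq_mul]
  exact (Finset.measurable_sum _ fun j _ => (measurable_extend k j).const_mul _).const_mul _

lemma measurable_energy : Measurable fun X : Coords N => energy N (rawField s X) := by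
  unfold energy
  refine (Finset.measurable_sum _ fun k _ => ?_).const_mul _
  refine (Finset.measurable_sum _ fun i _ => ?_).const_mul _
  exact (measurable_rawField k i).norm.pow_const 2

lemma measurable_field (k : Fin 3 → ℤ) (i : Fin 3) :
    Measurable fun X : Coords N => field s X k i := by
  simp only [field_eq, Pi.smul_apply]
  exact (Complex.measurable_ofReal.comp measurable_energy.sqrt.inv).smul (measurable_rawField k i)

lemma measurable_transfer (α β : Orbits N) :
    Measurable fun X : Coords N => transfer N (field s X) α β := by
  simp only [transfer, Matrix.of_apply, interaction, Matrix.mulVec, dotProduct, Pi.smul_apply,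
    Pi.star_apply, smul_eq_mul]
  refine (Finset.measurable_sum _ fun k _ => Finset.measurable_sum _ fun p _ => ?_).const_mul _
  refine (Complex.measurable_re.comp (Finset.measurable_sum _ fun i _ => ?_)).const_mul _
  refine (continuous_star.measurable.comp (measurable_field k.1 i)).mul
    ((Finset.measurable_sum _ fun j _ => ?_).const_mul _)
  refine ((Finset.measurable_sum _ fun l _ => ?_).mul_const _).const_mul _
  exact (measurable_field p.1 l).mul (measurable_field (k.1 - p.1) l)

lemma measurable_linftyNorm_V : Measurable fun X => linftyNorm (V s N X) := by
  simp only [linftyNorm_eq]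
  refine measurable_coe_nnreal_real.comp ?_
  have hc : Continuous fun w : Orbits N → ℝ≥0 => Finset.univ.sup fun α => w α :=
    Continuous.finset_sup_apply fun α _ => continuous_apply α
  refine hc.measurable.comp (measurable_pi_lambda _ fun α => Finset.measurable_sum _ fun β _ => ?_)
  exact (((measurable_transfer α β).add (measurable_transfer β α)).div_const 2).nnnorm

/-! ### Second moment, variance and tail bounds -/

lemma integrable_linftyNorm_V_sq (hs : s ≤ 1) (hN : 1 ≤ N) :
    Integrable (fun X => linftyNorm (V s N X) ^ 2) (ensemble N) :=
  (integrable_majorant.const_mul 9604).mono'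
    (measurable_linftyNorm_V.pow_const 2).aestronglyMeasurable
    (Eventually.of_forall fun X => by
      rw [Real.norm_of_nonneg (sq_nonneg _)]
      exact linftyNorm_V_sq_le hs hN X)

lemma memLp_linftyNorm_V (hs : s ≤ 1) (hN : 1 ≤ N) :
    MemLp (fun X => linftyNorm (V s N X)) 2 (ensemble N) :=
  (memLp_two_iff_integrable_sq measurable_linftyNorm_V.aestronglyMeasurable).2
    (integrable_linftyNorm_V_sq hs hN)

/-- The second moment of `‖V_N‖_∞` is `O(N⁻²)`. -/
lemma integral_linftyNorm_V_sq_le (hs : s ≤ 1) (hN : 1 ≤ N) :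
    ∫ X, linftyNorm (V s N X) ^ 2 ∂(ensemble N)
      ≤ 9604 * momentConst * (N : ℝ) ^ (-2 : ℝ) := by
  have e : (N : ℝ) ^ (-2 : ℝ) = ((N : ℝ) ^ 2)⁻¹ := by
    rw [Real.rpow_neg (Nat.cast_nonneg N)]
    norm_cast
  calc ∫ X, linftyNorm (V s N X) ^ 2 ∂(ensemble N)
      ≤ ∫ X, 9604 * majorant N X ∂(ensemble N) :=
        integral_mono (integrable_linftyNorm_V_sq hs hN) (integrable_majorant.const_mul _)
          (linftyNorm_V_sq_le hs hN)
    _ ≤ 9604 * (momentConst * ((N : ℝ) ^ 2)⁻¹) := by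
        rw [integral_const_mul]
        exact mul_le_mul_of_nonneg_left (integral_majorant_le hN) (by norm_num)
    _ = _ := by rw [e, mul_assoc]

lemma variance_linftyNorm_V_le (hs : s ≤ 1) (hN : 1 ≤ N) :
    Var[fun X => linftyNorm (V s N X); ensemble N]
      ≤ 9604 * momentConst * (N : ℝ) ^ (-2 : ℝ) :=
  (variance_le_expectation_sq measurable_linftyNorm_V.aestronglyMeasurable).trans
    (integral_linftyNorm_V_sq_le hs hN)

lemma measureReal_mean_add_lt_le (hs : s ≤ 1) (hN : 1 ≤ N) {δ : ℝ} (hδ : 0 < δ) :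
    (ensemble N).real {X | (∫ Y, linftyNorm (V s N Y) ∂(ensemble N)) + δ < linftyNorm (V s N X)}
      ≤ 9604 * momentConst * (N : ℝ) ^ (-2 : ℝ) / δ ^ 2 := by
  have h := meas_ge_le_variance_div_sq (memLp_linftyNorm_V hs hN) hδ
  have hv := variance_nonneg (fun X => linftyNorm (V s N X)) (ensemble N)
  calc _ ≤ (ensemble N).real {X | δ ≤ |linftyNorm (V s N X)
          - ∫ Y, linftyNorm (V s N Y) ∂(ensemble N)|} := by
        refine measureReal_mono fun X hX => ?_
        rw [Set.mem_ofPred_eq]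
        refine le_trans ?_ (le_abs_self _)
        have : (∫ Y, linftyNorm (V s N Y) ∂(ensemble N)) + δ < linftyNorm (V s N X) := hX
        linarith
    _ ≤ Var[fun X => linftyNorm (V s N X); ensemble N] / δ ^ 2 :=
        ENNReal.toReal_le_of_le_ofReal (by positivity) h
    _ ≤ _ := by
        gcongr
        exact variance_linftyNorm_V_le hs hN

/-- On this event `‖V_N‖_∞² ≥ 1`, so Markov's inequality at level 1 suffices, whatever the size of
`t`. -/
lemma measureReal_lt_rho_le (hs : s ≤ 1) (hN : 1 ≤ N) {t : ℝ} (ht : 1 ≤ t) :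
    (ensemble N).real {X | t < rho (V s N X)} ≤ 9604 * momentConst * (N : ℝ) ^ (-2 : ℝ) := by
  have hm := mul_meas_ge_le_integral_of_nonneg (f := fun X => linftyNorm (V s N X) ^ 2)
    (Eventually.of_forall fun X => sq_nonneg (linftyNorm (V s N X)))
    (integrable_linftyNorm_V_sq hs hN) 1
  rw [one_mul] at hm
  refine (measureReal_mono fun X hX => ?_).trans (hm.trans (integral_linftyNorm_V_sq_le hs hN))
  exact one_le_pow₀ ((ht.trans (le_of_lt hX)).trans (rho_le_linftyNorm _))

end OctahedralGalerkin

theorem mainTheorem10 (s : ℕ) (hs : s ≤ 1) :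
    (∃ C : ℝ, 0 < C ∧ ∀ N : ℕ, 1 ≤ N →
      MemLp (fun X => OctahedralGalerkin.linftyNorm (OctahedralGalerkin.V s N X)) 2
        (OctahedralGalerkin.ensemble N) ∧
      Var[fun X => OctahedralGalerkin.linftyNorm (OctahedralGalerkin.V s N X);
        OctahedralGalerkin.ensemble N] ≤ C * (N : ℝ) ^ (-2 : ℝ) ∧
      ∀ δ : ℝ, 0 < δ →
        (OctahedralGalerkin.ensemble N).real
          {X | (∫ Y, OctahedralGalerkin.linftyNorm (OctahedralGalerkin.V s N Y)
              ∂(OctahedralGalerkin.ensemble N)) + δ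
            < OctahedralGalerkin.linftyNorm (OctahedralGalerkin.V s N X)}
          ≤ C * (N : ℝ) ^ (-2 : ℝ) / δ ^ 2) ∧
    (∀ ε : ℝ, 0 < ε → ∀ γ : ℝ, 1 / 2 + ε < γ →
      Tendsto (fun N : ℕ => (OctahedralGalerkin.ensemble N).real
          {X | (N : ℝ) ^ γ < OctahedralGalerkin.rho (OctahedralGalerkin.V s N X)})
        atTop (𝓝 0)) := by
  refine ⟨⟨9604 * OctahedralGalerkin.momentConst,
    mul_pos (by norm_num) OctahedralGalerkin.momentConst_pos, fun N hN =>
      ⟨OctahedralGalerkin.memLp_linftyNorm_V hs hN,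
        OctahedralGalerkin.variance_linftyNorm_V_le hs hN,
        fun δ hδ => OctahedralGalerkin.measureReal_mean_add_lt_le hs hN hδ⟩⟩, fun ε hε γ hγ => ?_⟩
  have hlim : Tendsto (fun N : ℕ => 9604 * OctahedralGalerkin.momentConst * (N : ℝ) ^ (-2 : ℝ))
      atTop (𝓝 0) := by
    simpa using ((tendsto_rpow_neg_atTop (zero_lt_two' ℝ)).comp
      tendsto_natCast_atTop_atTop).const_mul (9604 * OctahedralGalerkin.momentConst)
  refine squeeze_zero' (Eventually.of_forall fun N => measureReal_nonneg) ?_ hlim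
  filter_upwards [eventually_ge_atTop 1] with N hN
  exact OctahedralGalerkin.measureReal_lt_rho_le hs hN
    (Real.one_le_rpow (by exact_mod_cast hN) (by linarith))
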